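/- Let $X=\{0,1\}$, let $X^*$ be the infinite binary rooted tree whose vertices are the finite words over $X$ (with an edge from $w$ to $wx$ for $w\in X^*$, $x\in X$), and let $G=\mathrm{Aut}(X^*)$ be its automorphism group. For $d\ge 1$ let $G(d)$ be the automorphism group of the finite subtree formed by the words of length at most $d$. For a vertex $v$ (of length less than $d$ in the case of $G(d)$) the label $g_{(v)}\in C_2=\{0,1\}$ of $g$ at $v$ is determined by $g(vx)=g(v)\,(x+g_{(v)} \bmod 2)$ for $x\in X$. A pattern group of size $d$ is a subgroup $P$ of $G(d)$; it is essential if for every $g\in P$ and $i\in\{0,1\}$ there is $h\in P$ such that $h_{(w)}=g_{(iw)}$ for all words $w$ of length less than $d-1$. The finitely constrained group $G_P$ defined by $P$ is the subgroup of all $g\in G$ such that for every $w\in X^*$ there is $p\in P$ with $g_{(wv)}=p_{(v)}$ for all words $v$ of length less than $d$. Equip $G$ with the metric $d(g,g)=0$ and $d(g,h)=1/[G:G_n]$ for $g\ne h$, where $n$ is the smallest level containing a vertex at which the labels of $g$ and $h$ differ, and $G_n$ is the subgroup of the automorphisms fixing every word of length $n$. A closed subgroup of $G$ is topologically finitely generated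 if it is the closure of a finitely generated subgroup of $G$. Theorem. Let $d\ge 2$ and let $P$ be an essential pattern group of size $d$. If the Hausdorff dimension of $G_P$ is $1-\frac{1}{2^{d-1}}$ (the largest value other than $1$ that is possible for size $d$), then $G_P$ is not topologically finitely generated. -/

import Mathlib

namespace BinaryTree

/-- The alphabet `X = {0, 1}`, also used as the cyclic group `C_2` that is identified with `Sym(X)`:
the element `a` of `C_2` acts on `X` by `x ↦ x + a`. -/
abbrev Letter : Type := ZMod 2

/-- The vertices of the infinite binary rooted tree: finite words over `X`. The root is `[]`. -/
abbrev Word : Type := List Letter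

/-- The edges `(w, wx)` of the binary rooted tree. -/
def IsChild (u v : Word) : Prop := ∃ x : Letter, v = u ++ [x]

/-- The group `G` of automorphisms of the infinite binary rooted tree. The product is composition,
`(g * h) w = g (h w)`. -/
abbrev TreeAut : Type := IsChild ≃r IsChild

/-- The vertices of the finite binary rooted tree of depth `d`: the words of length at most `d`. -/
abbrev FinVertex (d : ℕ) : Type := {w : Word // w.length ≤ d}

/-- The edges `(w, wx)` of the finite binary rooted tree of depth `d`. -/
def FinIsChild (d : ℕ) (u v : FinVertex d) : Prop := IsChild u.1 v.1

/-- The group `G(d)` of automorphisms of the finite binary rooted tree of depth `d`. -/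
abbrev FinTreeAut (d : ℕ) : Type := FinIsChild d ≃r FinIsChild d

/-- The label (activity) of `g` at the vertex `v`: the letter `a` such that `g (v0) = g(v) a`. Thus
`g (v x) = g(v) (x + a)` for every letter `x`, and `a` is the root action of the section of `g`
at `v`. -/
def label (g : TreeAut) (v : Word) : Letter := (g (v ++ [0])).getLastD 0

/-- The words of length smaller than `d`. -/
abbrev InnerVertex (d : ℕ) : Type := {w : Word // w.length < d}

/-- The child `v x` of a vertex `v` of level smaller than `d`. -/
def InnerVertex.child {d : ℕ} (v : InnerVertex d) (x : Letter) : FinVertex d :=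
  ⟨v.1 ++ [x], by have := v.2; simp only [List.length_append, List.length_singleton]; omega⟩

/-- A pattern of size `d`. -/
abbrev Pattern (d : ℕ) : Type := InnerVertex d → Letter

/-- The portrait of an element `g` of `G(d)`: the family of its labels, where the label of `g` at
`v` is the letter `a` such that `g (v0) = g(v) a`. -/
def portrait {d : ℕ} (g : FinTreeAut d) : Pattern d := fun v => (g (v.child 0)).1.getLastD 0

/-- The pattern `p` of size `d` appears at the vertex `w` in `g`. -/
def AppearsAt {d : ℕ} (p : Pattern d) (w : Word) (g : TreeAut) : Prop :=
  ∀ v : InnerVertex d, label g (w ++ v.1) = p v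

/-- The tree subshift defined by a set of forbidden patterns of size `d`. -/
def treeSubshift {d : ℕ} (F : Set (Pattern d)) : Set TreeAut :=
  {g | ∀ p ∈ F, ∀ w : Word, ¬ AppearsAt p w g}

/-- The pattern group `P` of size `d` is essential: for all `g ∈ P` and every letter `i` there is
`h ∈ P` whose label at `w` is the label of `g` at `iw`, for every word `w` of length smaller
than `d - 1`. -/
def IsEssential {d : ℕ} (P : Subgroup (FinTreeAut d)) : Prop :=
  ∀ g ∈ P, ∀ i : Letter, ∃ h ∈ P, ∀ (w : Word) (hw : (i :: w).length < d),
    portrait h ⟨w, lt_of_le_of_lt (Nat.le_succ _) hw⟩ = portrait g ⟨i :: w, hw⟩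

/-! ### Basic facts on automorphisms -/

theorem map_child (g : TreeAut) (w : Word) (x : Letter) :
    ∃ y : Letter, g (w ++ [x]) = g w ++ [y] :=
  g.map_rel_iff.2 ⟨x, rfl⟩

theorem map_append_zero (g : TreeAut) (w : Word) : g (w ++ [0]) = g w ++ [label g w] := by
  obtain ⟨y, hy⟩ := map_child g w 0
  simp [label, hy, List.getLastD_eq_getLast?]

theorem letter_aux (x y a : Letter) (hx : x ≠ 0) (h : y ≠ a) : y = x + a := by
  revert x y a; decide

theorem map_append_letter (g : TreeAut) (w : Word) (x : Letter) :
    g (w ++ [x]) = g w ++ [x + label g w] := by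
  by_cases hx : x = 0
  · subst hx; rw [map_append_zero, zero_add]
  · obtain ⟨y, hy⟩ := map_child g w x
    rw [hy, letter_aux x y (label g w) hx]
    rintro rfl
    rw [← map_append_zero] at hy
    exact hx (by simpa using g.injective hy)

theorem map_nil (g : TreeAut) : g [] = [] := by
  rcases List.eq_nil_or_concat (g []) with h | ⟨u, x, h⟩
  · exact h
  · exfalso
    obtain ⟨u', rfl⟩ := g.surjective u
    obtain ⟨y, hy⟩ := g.map_rel_iff.1 (show IsChild (g u') (g []) from ⟨x, by simpa using h⟩)
    simp at hy

theorem length_map (g : TreeAut) (w : Word) : (g w).length = w.length := by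
  induction w using List.reverseRecOn with
  | nil => rw [map_nil]
  | append_singleton w x ih => rw [map_append_letter]; simp [ih]

theorem label_mul (g h : TreeAut) (w : Word) :
    label (g * h) w = label g (h w) + label h w := by
  have h1 := map_append_zero (g * h) w
  rw [RelIso.mul_apply, RelIso.mul_apply, map_append_zero h, map_append_letter g] at h1
  have h2 : label h w + label g (h w) = label (g * h) w := by simpa using h1
  rw [← h2, add_comm]

theorem label_one (w : Word) : label 1 w = 0 := by
  simp [label, List.getLastD_eq_getLast?]

theorem label_inv (g : TreeAut) (w : Word) : label g⁻¹ w = label g (g⁻¹ w) := by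
  have h := label_mul g g⁻¹ w
  rw [mul_inv_cancel, label_one] at h
  have aux : ∀ a b : Letter, 0 = a + b → b = a := by decide
  exact aux _ _ h

/-- Automorphisms with the same labels on the levels below `n` agree on level `n`. -/
theorem eq_of_label_eq {g h : TreeAut} {n : ℕ}
    (H : ∀ u : Word, u.length < n → label g u = label h u) :
    ∀ w : Word, w.length ≤ n → g w = h w := by
  intro w
  induction w using List.reverseRecOn with
  | nil => intro _; rw [map_nil, map_nil]
  | append_singleton w x ih =>
    intro hw
    rw [List.length_append, List.length_singleton] at hw
    rw [map_append_letter, map_append_letter, ih (by omega), H w (by omega)]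

theorem ext_label {g h : TreeAut} (H : ∀ u : Word, label g u = label h u) : g = h :=
  RelIso.ext fun w => eq_of_label_eq (n := w.length) (fun u _ => H u) w le_rfl

/-- The vertex `v` as a vertex of the tree of depth `d`. -/
def InnerVertex.toFin {d : ℕ} (v : InnerVertex d) : FinVertex d := ⟨v.1, v.2.le⟩

theorem fin_map_child {d : ℕ} (g : FinTreeAut d) (v : InnerVertex d) (x : Letter) :
    ∃ y : Letter, (g (v.child x)).1 = (g v.toFin).1 ++ [y] :=
  g.map_rel_iff.2 (show FinIsChild d v.toFin (v.child x) from ⟨x, rfl⟩)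

theorem fin_map_child_zero {d : ℕ} (g : FinTreeAut d) (v : InnerVertex d) :
    (g (v.child 0)).1 = (g v.toFin).1 ++ [portrait g v] := by
  obtain ⟨y, hy⟩ := fin_map_child g v 0
  simp [portrait, hy, List.getLastD_eq_getLast?]

theorem fin_map_child_letter {d : ℕ} (g : FinTreeAut d) (v : InnerVertex d) (x : Letter) :
    (g (v.child x)).1 = (g v.toFin).1 ++ [x + portrait g v] := by
  by_cases hx : x = 0
  · subst hx; rw [fin_map_child_zero, zero_add]
  · obtain ⟨y, hy⟩ := fin_map_child g v x
    rw [hy, letter_aux x y (portrait g v) hx]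
    rintro rfl
    rw [← fin_map_child_zero] at hy
    have := congrArg Subtype.val (g.injective (Subtype.ext hy))
    exact hx (by simpa [InnerVertex.child] using this)

theorem fin_map_nil {d : ℕ} (g : FinTreeAut d) : (g ⟨[], Nat.zero_le d⟩).1 = [] := by
  rcases List.eq_nil_or_concat (g ⟨[], Nat.zero_le d⟩).1 with h | ⟨u, x, h⟩
  · exact h
  · exfalso
    have hu : u.length ≤ d := by
      have := (g ⟨[], Nat.zero_le d⟩).2
      rw [h] at this
      simp at this
      omega
    obtain ⟨u', hu'⟩ := g.surjective ⟨u, hu⟩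
    obtain ⟨y, hy⟩ := g.map_rel_iff.1
      (show FinIsChild d (g u') (g ⟨[], Nat.zero_le d⟩) from ⟨x, by rw [hu']; simpa using h⟩)
    simp at hy

theorem fin_length_map {d : ℕ} (g : FinTreeAut d) :
    ∀ (w : Word) (hw : w.length ≤ d), (g ⟨w, hw⟩).1.length = w.length := by
  intro w
  induction w using List.reverseRecOn with
  | nil => intro hw; rw [fin_map_nil]
  | append_singleton w x ih =>
    intro hw
    have hw' : w.length < d := by simpa using hw
    have h1 := fin_map_child_letter g ⟨w, hw'⟩ x
    have h2 := ih hw'.le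
    simp only [InnerVertex.child, InnerVertex.toFin] at h1
    rw [h1]
    simp [h2]

/-- The action of `G(d)` on the vertices of level smaller than `d`. -/
def innerMap {d : ℕ} (g : FinTreeAut d) (v : InnerVertex d) : InnerVertex d :=
  ⟨(g v.toFin).1, lt_of_eq_of_lt (fin_length_map g v.1 v.2.le) v.2⟩

theorem portrait_mul {d : ℕ} (g h : FinTreeAut d) (v : InnerVertex d) :
    portrait (g * h) v = portrait g (innerMap h v) + portrait h v := by
  have h1 := fin_map_child_zero (g * h) v
  have h2 : h (v.child 0) = (innerMap h v).child (portrait h v) :=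
    Subtype.ext (fin_map_child_zero h v)
  rw [RelIso.mul_apply, RelIso.mul_apply, h2, fin_map_child_letter g] at h1
  have h3 : portrait h v + portrait g (innerMap h v) = portrait (g * h) v :=
    List.singleton_injective (List.append_cancel_left h1)
  rw [← h3, add_comm]

theorem portrait_one {d : ℕ} (v : InnerVertex d) : portrait (1 : FinTreeAut d) v = 0 := by
  simp [portrait, InnerVertex.child, List.getLastD_eq_getLast?]

theorem portrait_inv {d : ℕ} (g : FinTreeAut d) (v : InnerVertex d) :
    portrait g⁻¹ v = portrait g (innerMap g⁻¹ v) := by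
  have h := portrait_mul g g⁻¹ v
  rw [mul_inv_cancel, portrait_one] at h
  have aux : ∀ a b : Letter, 0 = a + b → b = a := by decide
  exact aux _ _ h

theorem map_append_of_appearsAt {d : ℕ} {p : FinTreeAut d} {w : Word} {g : TreeAut}
    (H : AppearsAt (portrait p) w g) :
    ∀ (v : Word) (hv : v.length ≤ d), g (w ++ v) = g w ++ (p ⟨v, hv⟩).1 := by
  intro v
  induction v using List.reverseRecOn with
  | nil => intro hv; rw [fin_map_nil]; simp
  | append_singleton v x ih =>
    intro hv
    have hv' : v.length < d := by simpa using hv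
    have h1 := fin_map_child_letter p ⟨v, hv'⟩ x
    simp only [InnerVertex.child, InnerVertex.toFin] at h1
    rw [h1, ← List.append_assoc, map_append_letter, ih hv'.le, H ⟨v, hv'⟩, List.append_assoc]

theorem mem_treeSubshift_compl {d : ℕ} {A : Set (Pattern d)} {g : TreeAut} :
    g ∈ treeSubshift Aᶜ ↔ ∀ w : Word, ∃ p ∈ A, AppearsAt p w g := by
  constructor
  · intro h w
    by_contra hc
    exact h (fun v => label g (w ++ v.1)) (fun hA => hc ⟨_, hA, fun _ => rfl⟩) w (fun _ => rfl)
  · rintro h p hp w hw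
    obtain ⟨q, hq, hqw⟩ := h w
    have : p = q := funext fun v => (hw v).symm.trans (hqw v)
    exact hp (this ▸ hq)

/-- The finitely constrained group `G_P` defined by the pattern group `P` of size `d`: the tree
subshift of finite type whose forbidden patterns are the patterns of size `d` that are not the
portrait of an element of `P`. -/
def finitelyConstrainedGroup {d : ℕ} (P : Subgroup (FinTreeAut d)) : Subgroup TreeAut where
  carrier := treeSubshift (portrait '' (P : Set (FinTreeAut d)))ᶜ
  one_mem' := by
    rw [mem_treeSubshift_compl]
    exact fun w => ⟨_, ⟨1, P.one_mem, rfl⟩, fun v => by rw [label_one, portrait_one]⟩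
  mul_mem' := by
    intro g h hg hh
    rw [mem_treeSubshift_compl] at *
    intro w
    obtain ⟨_, ⟨q, hq, rfl⟩, hqw⟩ := hh w
    obtain ⟨_, ⟨p, hp, rfl⟩, hpw⟩ := hg (h w)
    refine ⟨_, ⟨p * q, P.mul_mem hp hq, rfl⟩, fun v => ?_⟩
    rw [label_mul, portrait_mul, map_append_of_appearsAt hqw v.1 v.2.le, hqw v]
    exact congrArg (· + portrait q v) (hpw (innerMap q v))
  inv_mem' := by
    intro g hg
    simp only [mem_treeSubshift_compl] at *
    intro w
    obtain ⟨_, ⟨p, hp, rfl⟩, hpw⟩ := hg (g⁻¹ w)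
    refine ⟨_, ⟨p⁻¹, P.inv_mem hp, rfl⟩, fun v => ?_⟩
    have key : g⁻¹ (w ++ v.1) = g⁻¹ w ++ (innerMap p⁻¹ v).1 := by
      apply g.injective
      rw [map_append_of_appearsAt hpw _ (innerMap p⁻¹ v).2.le, RelIso.apply_inv_self,
        RelIso.apply_inv_self]
      have : p ⟨(innerMap p⁻¹ v).1, (innerMap p⁻¹ v).2.le⟩ = v.toFin :=
        RelIso.apply_inv_self p v.toFin
      rw [this]
      rfl
    rw [label_inv, portrait_inv, key]
    exact hpw (innerMap p⁻¹ v)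

/-! ### The metric on `G` -/

/-- The level `n` stabilizer `G_n` of `G`. -/
def levelStabilizer (n : ℕ) : Subgroup TreeAut where
  carrier := {g | ∀ v : Word, v.length = n → g v = v}
  one_mem' := fun _ _ => rfl
  mul_mem' := by
    intro g h hg hh v hv
    rw [RelIso.mul_apply, hh v hv, hg v hv]
  inv_mem' := by
    intro g hg v hv
    apply g.injective
    rw [RelIso.apply_inv_self, hg v hv]

theorem levelStabilizer_antitone : Antitone levelStabilizer := by
  refine antitone_nat_of_succ_le fun n g hg v hv => ?_
  have h := hg (v ++ [0]) (by simp [hv])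
  rw [map_append_letter] at h
  exact (List.append_inj' h rfl).1

theorem levelStabilizer_index_ne_zero (n : ℕ) : (levelStabilizer n).index ≠ 0 := by
  have hfin : Finite {w : Word // w.length = n} := List.finite_length_eq Letter n
  let f : TreeAut ⧸ levelStabilizer n → {w : Word // w.length = n} → {w : Word // w.length = n} :=
    fun q v => ⟨q.out v.1, (length_map _ _).trans v.2⟩
  have hf : Function.Injective f := by
    intro q r hqr
    rw [← q.out_eq', ← r.out_eq', QuotientGroup.eq]
    intro v hv
    have h : q.out v = r.out v := congrArg Subtype.val (congrFun hqr ⟨v, hv⟩)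
    rw [RelIso.mul_apply, ← h, RelIso.inv_apply_self]
  have : Finite (TreeAut ⧸ levelStabilizer n) := Finite.of_injective f hf
  exact Nat.card_pos.ne'

/-- The first level on which the labels of `g` and `h` differ (if `g ≠ h`). -/
noncomputable def firstDifference (g h : TreeAut) : ℕ :=
  sInf {k | ∃ u : Word, u.length = k ∧ label g u ≠ label h u}

theorem firstDifference_comm (g h : TreeAut) : firstDifference g h = firstDifference h g := by
  simp only [firstDifference, ne_comm]

theorem min_firstDifference_le {f g h : TreeAut} (hfh : f ≠ h) :
    min (firstDifference f g) (firstDifference g h) ≤ firstDifference f h := by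
  have hne : {k | ∃ u : Word, u.length = k ∧ label f u ≠ label h u}.Nonempty := by
    by_contra hc
    refine hfh (ext_label fun u => ?_)
    by_contra hu
    exact hc ⟨_, u, rfl, hu⟩
  obtain ⟨u, hu, hne'⟩ := Nat.sInf_mem hne
  by_cases h1 : label f u = label g u
  · exact (min_le_right _ _).trans (Nat.sInf_le ⟨u, hu, h1 ▸ hne'⟩)
  · exact (min_le_left _ _).trans (Nat.sInf_le ⟨u, hu, h1⟩)

open Classical in
/-- The distance on `G`: `d(g, g) = 0`, and `d(g, h) = 1 / [G : G_n]` if `g ≠ h`, where `n` is the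
first level on which the labels of `g` and `h` differ. -/
noncomputable def treeDist (g h : TreeAut) : ℝ :=
  if g = h then 0 else 1 / ((levelStabilizer (firstDifference g h)).index : ℝ)

theorem treeDist_nonneg (g h : TreeAut) : 0 ≤ treeDist g h := by
  unfold treeDist; split_ifs <;> positivity

theorem one_div_index_mono {m n : ℕ} (h : m ≤ n) :
    1 / ((levelStabilizer n).index : ℝ) ≤ 1 / ((levelStabilizer m).index : ℝ) := by
  have h0 : 0 < (levelStabilizer m).index :=
    Nat.pos_of_ne_zero (levelStabilizer_index_ne_zero m)
  have h1 : (levelStabilizer m).index ≤ (levelStabilizer n).index :=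
    Nat.le_of_dvd (Nat.pos_of_ne_zero (levelStabilizer_index_ne_zero n))
      (Subgroup.index_dvd_of_le (levelStabilizer_antitone h))
  exact one_div_le_one_div_of_le (by exact_mod_cast h0) (by exact_mod_cast h1)

noncomputable instance : MetricSpace TreeAut where
  dist := treeDist
  dist_self g := by simp [treeDist]
  dist_comm g h := by
    rcases eq_or_ne g h with rfl | hne
    · rfl
    · simp only [treeDist, firstDifference_comm g h, hne, hne.symm, if_false]
  dist_triangle f g h := by
    by_cases hfg : f = g
    · subst hfg; simp [treeDist]
    by_cases hgh : g = h
    · subst hgh; simp [treeDist]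
    by_cases hfh : f = h
    · simpa [treeDist, hfh] using add_nonneg (treeDist_nonneg f g) (treeDist_nonneg g h)
    · simp only [treeDist, hfg, hgh, hfh, if_false]
      rcases min_le_iff.1 (min_firstDifference_le (g := g) hfh) with h' | h'
      · exact (one_div_index_mono h').trans (le_add_of_nonneg_right (by positivity))
      · exact (one_div_index_mono h').trans (le_add_of_nonneg_left (by positivity))
  eq_of_dist_eq_zero := by
    intro g h H
    by_contra hne
    have h0 : 1 / ((levelStabilizer (firstDifference g h)).index : ℝ) = 0 := by
      simpa [treeDist, hne] using H
    rw [one_div, inv_eq_zero, Nat.cast_eq_zero] at h0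
    exact levelStabilizer_index_ne_zero _ h0

/-- The (closed) subgroup `H` of `G` is topologically finitely generated: it is the closure of a
finitely generated subgroup of `G`. -/
def IsTopologicallyFG (H : Subgroup TreeAut) : Prop :=
  ∃ K : Subgroup TreeAut, K.FG ∧ closure (K : Set TreeAut) = (H : Set TreeAut)

end BinaryTree

namespace BinaryTree

/-! Write `Q` for `rootPatternGroup P`, the preimage of `P` in `G`. The dimension hypothesis forces
`Q` to have index exactly 2 in `G`, and a group `G_P` of this kind has infinitely many homomorphisms
onto nontrivial subgroups of `ZMod 4`.

Index two. For a self-similar `H`, the index `[H ∩ G_n : H ∩ G_{n+1}]` at most squares when `n`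
grows by one, so its value at a single level bounds the Hausdorff dimension (`dimH_le_of_sec_mem`).
With `n = d - 1`, an index `[G_n : Q ∩ G_n] ≥ 4` would make the dimension at most `1 - 2 / 2 ^ (d -
1)`; hence this index divides 2. Essentiality then makes `Q` surject onto `G / G_{d-1}`
(`exists_agree_mem`), so `Q` has index at most 2 in `G`. Index 1 would give `G_P = G`, of dimension
at least 1 (`one_le_dimH_univ`). So `Q` is the kernel of a nontrivial character `χ : G → ZMod 2`.

Infinitely many homomorphisms. Let `ε` be the value of `χ` on the root swap and `χ₀(g) = χ((g, 1))`.
Then `χ(g) = ε · label(g) + χ₀(g_0) + χ₀(g_1)`, and this vanishes on `G_P`. Therefore `2 χ₀(g_0) + ε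
· label(g)`, read in `ZMod 4`, is additive on `G_P`: the change of `χ₀(g_0)` when the two sections
are exchanged cancels the carry of the labels. Summing over the sections at level `n` gives the
homomorphism `levelChar χ n`. Some `γ ∈ G_P` stabilizing level `d - 1` takes the value 2 at level 0;
its copy at the vertex `0 ⋯ 0` of level `m` is sent to 2 by the homomorphism of level `m` and to 0
by those of level `n < m`. So all these continuous homomorphisms are distinct, which is impossible
for a topologically finitely generated group (`IsTopologicallyFG.exists_eq`). -/

/-! ### Automorphisms with prescribed labels, and sections -/

/-- The map on words given by a family of labels. -/
def labelMap : (Word → Letter) → Word → Word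
  | _, [] => []
  | l, x :: w => (x + l []) :: labelMap (fun v => l (x :: v)) w

/-- The inverse of `labelMap`. -/
def labelMapInv : (Word → Letter) → Word → Word
  | _, [] => []
  | l, x :: w => (x + l []) :: labelMapInv (fun v => l ((x + l []) :: v)) w

theorem letter_add_add_cancel (x a : Letter) : x + a + a = x := by
  revert x a; decide

theorem labelMapInv_labelMap (l : Word → Letter) (w : Word) :
    labelMapInv l (labelMap l w) = w := by
  induction w generalizing l with
  | nil => rfl
  | cons x w ih => simp [labelMap, labelMapInv, letter_add_add_cancel, ih]

theorem labelMap_labelMapInv (l : Word → Letter) (w : Word) :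
    labelMap l (labelMapInv l w) = w := by
  induction w generalizing l with
  | nil => rfl
  | cons x w ih => simp [labelMap, labelMapInv, letter_add_add_cancel, ih]

theorem labelMap_append_letter (l : Word → Letter) (w : Word) (x : Letter) :
    labelMap l (w ++ [x]) = labelMap l w ++ [x + l w] := by
  induction w generalizing l with
  | nil => rfl
  | cons y w ih => simp [labelMap, ih]

/-- The automorphism with prescribed labels. -/
def ofLabels (l : Word → Letter) : TreeAut where
  toFun := labelMap l
  invFun := labelMapInv l
  left_inv := labelMapInv_labelMap l
  right_inv := labelMap_labelMapInv l
  map_rel_iff' := by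
    intro u v
    constructor
    · rintro ⟨y, hy⟩
      refine ⟨y + l u, Function.LeftInverse.injective (labelMapInv_labelMap l) ?_⟩
      rw [labelMap_append_letter, letter_add_add_cancel]
      exact hy
    · rintro ⟨x, rfl⟩
      exact ⟨_, labelMap_append_letter l u x⟩

@[simp]
theorem label_ofLabels (l : Word → Letter) (w : Word) : label (ofLabels l) w = l w := by
  have h : ofLabels l (w ++ [0]) = ofLabels l w ++ [0 + l w] := labelMap_append_letter l w 0
  rw [map_append_zero] at h
  simpa using h

/-- The section of `g` at the letter `i`. -/
def sec (g : TreeAut) (i : Letter) : TreeAut := ofLabels fun v => label g (i :: v)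

@[simp]
theorem label_sec (g : TreeAut) (i : Letter) (v : Word) : label (sec g i) v = label g (i :: v) :=
  label_ofLabels _ _

theorem map_cons (g : TreeAut) (i : Letter) (v : Word) :
    g (i :: v) = (i + label g []) :: sec g i v := by
  induction v using List.reverseRecOn with
  | nil => simpa [map_nil] using map_append_letter g [] i
  | append_singleton v x ih =>
    rw [← List.cons_append, map_append_letter, ih, map_append_letter, label_sec]
    rfl

theorem ext_sec {g h : TreeAut} (h0 : label g [] = label h []) (hs : ∀ i, sec g i = sec h i) :
    g = h := by
  refine ext_label fun u => ?_
  cases u with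
  | nil => exact h0
  | cons i v => rw [← label_sec, hs, label_sec]

theorem sec_mul (g h : TreeAut) (i : Letter) :
    sec (g * h) i = sec g (i + label h []) * sec h i := by
  refine ext_label fun u => ?_
  rw [label_sec, label_mul, label_mul, map_cons, label_sec, label_sec]

@[simp]
theorem sec_one (i : Letter) : sec 1 i = 1 :=
  ext_label fun u => by rw [label_sec, label_one, label_one]

/-- The automorphism with root label `a` and sections `f`. -/
def branch (a : Letter) (f : Letter → TreeAut) : TreeAut :=
  ofLabels fun
    | [] => a
    | i :: v => label (f i) v

@[simp]
theorem label_branch_nil (a : Letter) (f : Letter → TreeAut) : label (branch a f) [] = a :=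
  label_ofLabels _ _

@[simp]
theorem sec_branch (a : Letter) (f : Letter → TreeAut) (i : Letter) : sec (branch a f) i = f i :=
  ext_label fun u => by rw [label_sec, branch, label_ofLabels]

theorem branch_mul_branch_zero (a : Letter) (f f' : Letter → TreeAut) :
    branch a f * branch 0 f' = branch a (f * f') :=
  ext_sec (by simp [label_mul, map_nil]) fun i => by simp [sec_mul]

theorem branch_zero_one : branch 0 1 = 1 :=
  ext_sec (by simp [label_one]) fun i => by simp

/-! ### Agreement up to a level, level stabilizers and the metric -/

/-- `g` and `h` have the same labels on the levels below `n`. -/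
def Agree (n : ℕ) (g h : TreeAut) : Prop := ∀ u : Word, u.length < n → label g u = label h u

theorem Agree.refl (n : ℕ) (g : TreeAut) : Agree n g g := fun _ _ => rfl

theorem Agree.symm {n : ℕ} {g h : TreeAut} (H : Agree n g h) : Agree n h g :=
  fun u hu => (H u hu).symm

theorem Agree.trans {n : ℕ} {f g h : TreeAut} (H : Agree n f g) (H' : Agree n g h) :
    Agree n f h :=
  fun u hu => (H u hu).trans (H' u hu)

theorem Agree.mono {m n : ℕ} (hmn : m ≤ n) {g h : TreeAut} (H : Agree n g h) : Agree m g h :=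
  fun u hu => H u (hu.trans_le hmn)

theorem agree_zero (g h : TreeAut) : Agree 0 g h := fun _ hu => absurd hu (Nat.not_lt_zero _)

theorem agree_succ_iff {n : ℕ} {g h : TreeAut} :
    Agree (n + 1) g h ↔ label g [] = label h [] ∧ ∀ i, Agree n (sec g i) (sec h i) := by
  constructor
  · intro H
    refine ⟨H [] (by simp), fun i u hu => ?_⟩
    rw [label_sec, label_sec]
    exact H _ (by simpa using hu)
  · rintro ⟨h0, hs⟩ u hu
    cases u with
    | nil => exact h0
    | cons i v =>
      rw [← label_sec, ← label_sec]
      exact hs i v (by simpa using hu)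

theorem agree_iff_map_eq {n : ℕ} {g h : TreeAut} :
    Agree n g h ↔ ∀ w : Word, w.length ≤ n → g w = h w := by
  refine ⟨eq_of_label_eq, fun H u hu => ?_⟩
  rw [label, label, H _ (by simpa using hu)]

theorem Agree.mul {n : ℕ} {g g' h h' : TreeAut} (H : Agree n g g') (H' : Agree n h h') :
    Agree n (g * h) (g' * h') := by
  rw [agree_iff_map_eq] at *
  intro w hw
  rw [RelIso.mul_apply, RelIso.mul_apply, H' w hw, H _ (by rwa [length_map])]

theorem mem_levelStabilizer_iff_map {n : ℕ} {g : TreeAut} :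
    g ∈ levelStabilizer n ↔ ∀ w : Word, w.length ≤ n → g w = w :=
  ⟨fun hg w hw => levelStabilizer_antitone hw hg w rfl, fun H v hv => H v hv.le⟩

theorem mem_levelStabilizer {n : ℕ} {g : TreeAut} : g ∈ levelStabilizer n ↔ Agree n g 1 := by
  rw [mem_levelStabilizer_iff_map, agree_iff_map_eq]
  rfl

theorem agree_iff_inv_mul_mem {n : ℕ} {g h : TreeAut} :
    Agree n g h ↔ g⁻¹ * h ∈ levelStabilizer n := by
  rw [mem_levelStabilizer]
  constructor
  · intro H
    simpa using (Agree.refl n g⁻¹).mul H.symm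
  · intro H
    simpa using ((Agree.refl n g).mul H).symm

theorem mem_levelStabilizer_succ {n : ℕ} {g : TreeAut} :
    g ∈ levelStabilizer (n + 1) ↔ label g [] = 0 ∧ ∀ i, sec g i ∈ levelStabilizer n := by
  simp only [mem_levelStabilizer, agree_succ_iff, sec_one, label_one]

theorem branch_zero_mem_levelStabilizer {n : ℕ} {f : Letter → TreeAut}
    (hf : ∀ i, f i ∈ levelStabilizer n) : branch 0 f ∈ levelStabilizer (n + 1) :=
  mem_levelStabilizer_succ.2 ⟨by simp, by simpa using hf⟩

theorem branch_mulSingle_mem_levelStabilizer {n : ℕ} {g : TreeAut} (hg : g ∈ levelStabilizer n)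
    (i : Letter) : branch 0 (Pi.mulSingle i g) ∈ levelStabilizer (n + 1) := by
  refine branch_zero_mem_levelStabilizer fun j => ?_
  rcases eq_or_ne j i with rfl | hj
  · simpa using hg
  · simp [hj]

theorem agree_of_dist_lt {n : ℕ} {g h : TreeAut}
    (H : dist g h < 1 / ((levelStabilizer n).index : ℝ)) : Agree n g h := by
  intro u hu
  by_contra hne
  have hgh : g ≠ h := by rintro rfl; exact hne rfl
  have hmem : u.length ∈ {k | ∃ u : Word, u.length = k ∧ label g u ≠ label h u} := ⟨u, rfl, hne⟩
  have h1 : firstDifference g h ≤ n := (Nat.sInf_le hmem).trans hu.le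
  have h2 : dist g h = 1 / ((levelStabilizer (firstDifference g h)).index : ℝ) := if_neg hgh
  rw [h2] at H
  exact absurd (one_div_index_mono h1) (not_le.2 H)

theorem Agree.dist_le {n : ℕ} {g h : TreeAut} (H : Agree n g h) :
    dist g h ≤ 1 / ((levelStabilizer n).index : ℝ) := by
  rcases eq_or_ne g h with rfl | hne
  · rw [dist_self]; positivity
  · have h2 : dist g h = 1 / ((levelStabilizer (firstDifference g h)).index : ℝ) := if_neg hne
    rw [h2]
    refine one_div_index_mono ?_
    have hs : {k | ∃ u : Word, u.length = k ∧ label g u ≠ label h u}.Nonempty := by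
      by_contra hc
      refine hne (ext_label fun u => ?_)
      by_contra hu
      exact hc ⟨_, u, rfl, hu⟩
    obtain ⟨u, hu, hu'⟩ := Nat.sInf_mem hs
    by_contra hlt
    exact hu' (H u (by rw [hu]; exact not_le.1 hlt))

/-! ### The indices of the level stabilizers -/

/-- On the stabilizer of the first level, the section at a letter is a homomorphism. -/
def secHom (i : Letter) : levelStabilizer 1 →* TreeAut where
  toFun g := sec g.1 i
  map_one' := sec_one i
  map_mul' g h := by
    have h0 : label h.1 [] = 0 := (mem_levelStabilizer_succ.1 h.2).1
    simp [sec_mul, h0]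

theorem levelStabilizer_zero : levelStabilizer 0 = ⊤ :=
  eq_top_iff.2 fun _ _ => mem_levelStabilizer.2 (agree_zero _ _)

theorem levelStabilizer_subgroupOf (n : ℕ) :
    (levelStabilizer (n + 1)).subgroupOf (levelStabilizer 1) =
      (levelStabilizer n).comap (secHom 0) ⊓ (levelStabilizer n).comap (secHom 1) := by
  ext g
  have h0 : label g.1 [] = 0 := (mem_levelStabilizer_succ.1 g.2).1
  have hall : ∀ p : Letter → Prop, (∀ i, p i) ↔ p 0 ∧ p 1 := fun p => Fin.forall_fin_two
  rw [Subgroup.mem_subgroupOf, mem_levelStabilizer_succ, hall, Subgroup.mem_inf]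
  simp only [h0, true_and]
  rfl

theorem index_levelStabilizer_one : (levelStabilizer 1).index = 2 := by
  refine Subgroup.index_eq_two_iff.2 ⟨branch 1 1, fun g => ?_⟩
  have h : ∀ g, g ∈ levelStabilizer 1 ↔ label g [] = 0 := fun g => by
    simp [mem_levelStabilizer_succ, levelStabilizer_zero]
  rw [h, h, label_mul, map_nil, label_branch_nil]
  generalize label g [] = a
  revert a; decide

/-- The pair of sections maps `G_1` onto `G × G`, with `G_{n+1}` the preimage of `G_n × G_n`; the
factor 2 is the index of `G_1`. -/
theorem index_levelStabilizer_succ (n : ℕ) :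
    (levelStabilizer (n + 1)).index = (levelStabilizer n).index ^ 2 * 2 := by
  have hsurj : Function.Surjective ((secHom 0).prod (secHom 1)) := by
    rintro ⟨g, h⟩
    refine ⟨⟨branch 0 (fun i => if i = 0 then g else h), ?_⟩, ?_⟩
    · simp [mem_levelStabilizer_succ, levelStabilizer_zero]
    · simp [secHom]
  have hcomap : (levelStabilizer (n + 1)).subgroupOf (levelStabilizer 1) =
      ((levelStabilizer n).prod (levelStabilizer n)).comap ((secHom 0).prod (secHom 1)) :=
    levelStabilizer_subgroupOf n
  rw [← Subgroup.relIndex_mul_index (levelStabilizer_antitone (Nat.le_add_left 1 n)),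
    Subgroup.relIndex, hcomap, Subgroup.index_comap_of_surjective _ hsurj, Subgroup.index_prod,
    index_levelStabilizer_one, sq]

theorem index_levelStabilizer (n : ℕ) : (levelStabilizer n).index = 2 ^ (2 ^ n - 1) := by
  induction n with
  | zero => simp [levelStabilizer_zero]
  | succ n ih =>
    rw [index_levelStabilizer_succ, ih, ← pow_mul, ← pow_succ]
    congr 1
    have := Nat.one_le_two_pow (n := n)
    rw [pow_succ]
    omega

/-- `relIndex` takes the value 0 for infinite index, so monotonicity of indices requires this
finiteness. -/
theorem relIndex_levelStabilizer_ne_zero (n : ℕ) (H : Subgroup TreeAut) :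
    (levelStabilizer n).relIndex H ≠ 0 := by
  intro h
  have := Subgroup.relIndex_eq_zero_of_le_right (le_top : H ≤ ⊤) h
  rw [Subgroup.relIndex_top_right] at this
  exact levelStabilizer_index_ne_zero n this

theorem relIndex_levelStabilizer_succ (n : ℕ) :
    (levelStabilizer (n + 1)).relIndex (levelStabilizer n) = 2 ^ 2 ^ n := by
  have h := Subgroup.relIndex_mul_index (levelStabilizer_antitone (Nat.le_add_right n 1))
  rw [index_levelStabilizer, index_levelStabilizer] at h
  have h1 := Nat.one_le_two_pow (n := n)
  have h2 : 2 ^ (n + 1) - 1 = 2 ^ n + (2 ^ n - 1) := by rw [pow_succ]; omega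
  rw [h2, pow_add] at h
  exact Nat.eq_of_mul_eq_mul_right (by positivity) h

/-! ### An upper bound for the Hausdorff dimension of a self-similar group -/

/-- Modulo `G_{n+2}`, an element of `H ∩ G_{n+1}` is determined by its two sections modulo
`G_{n+1}`, and these lie in `H ∩ G_n` by self-similarity. -/
theorem relIndex_succ_le_sq {H : Subgroup TreeAut} (hH : ∀ g ∈ H, ∀ i, sec g i ∈ H) (n : ℕ) :
    (levelStabilizer (n + 2)).relIndex (H ⊓ levelStabilizer (n + 1)) ≤
      (levelStabilizer (n + 1)).relIndex (H ⊓ levelStabilizer n) ^ 2 := by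
  have hle : H ⊓ levelStabilizer (n + 1) ≤ levelStabilizer 1 :=
    inf_le_right.trans (levelStabilizer_antitone (Nat.le_add_left 1 n))
  have hmap : ∀ i, ((H ⊓ levelStabilizer (n + 1)).subgroupOf (levelStabilizer 1)).map (secHom i) ≤
      H ⊓ levelStabilizer n := by
    rintro i _ ⟨g, hg, rfl⟩
    exact ⟨hH _ hg.1 i, (mem_levelStabilizer_succ.1 hg.2).2 i⟩
  rw [← Subgroup.relIndex_subgroupOf hle, levelStabilizer_subgroupOf, sq]
  refine Subgroup.relIndex_inf_le.trans ?_
  rw [Subgroup.relIndex_comap, Subgroup.relIndex_comap]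
  exact Nat.mul_le_mul
    (Subgroup.relIndex_le_of_le_right (hmap 0) (relIndex_levelStabilizer_ne_zero _ _))
    (Subgroup.relIndex_le_of_le_right (hmap 1) (relIndex_levelStabilizer_ne_zero _ _))

theorem relIndex_le_pow {H : Subgroup TreeAut} (hH : ∀ g ∈ H, ∀ i, sec g i ∈ H) {n m : ℕ}
    (hm : (levelStabilizer (n + 1)).relIndex (H ⊓ levelStabilizer n) ≤ m) (k : ℕ) :
    (levelStabilizer (n + k + 1)).relIndex (H ⊓ levelStabilizer (n + k)) ≤ m ^ 2 ^ k := by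
  induction k with
  | zero => simpa using hm
  | succ k ih =>
    refine (relIndex_succ_le_sq hH (n + k)).trans ?_
    rw [pow_succ 2 k, pow_mul]
    exact Nat.pow_le_pow_left ih 2

theorem relIndex_levelStabilizer_le {H : Subgroup TreeAut} (hH : ∀ g ∈ H, ∀ i, sec g i ∈ H)
    {n m : ℕ} (hm0 : 0 < m)
    (hm : (levelStabilizer (n + 1)).relIndex (H ⊓ levelStabilizer n) ≤ m) (k : ℕ) :
    (levelStabilizer (n + k)).relIndex H ≤ (levelStabilizer n).relIndex H * m ^ (2 ^ k) := by
  -- The natural exponent is `1 + 2 + ⋯ + 2 ^ (k - 1)`, one factor for each level passed.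
  suffices h : (levelStabilizer (n + k)).relIndex H ≤
      (levelStabilizer n).relIndex H * m ^ (2 ^ k - 1) from
    h.trans (Nat.mul_le_mul le_rfl (Nat.pow_le_pow_right hm0 (Nat.sub_le _ _)))
  induction k with
  | zero => simp
  | succ k ih =>
    have h1 : (levelStabilizer (n + k + 1)).relIndex H =
        (levelStabilizer (n + k + 1)).relIndex (H ⊓ levelStabilizer (n + k)) *
          (levelStabilizer (n + k)).relIndex H := by
      have h := Subgroup.relIndex_inf_mul_relIndex (levelStabilizer (n + k + 1))
        (levelStabilizer (n + k)) H
      rw [inf_eq_left.2 (levelStabilizer_antitone (Nat.le_add_right (n + k) 1))] at h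
      rw [inf_comm, h]
    have h2 : 2 ^ (k + 1) - 1 = 2 ^ k + (2 ^ k - 1) := by
      have := Nat.one_le_two_pow (n := k)
      rw [pow_succ]; omega
    rw [← add_assoc, h1, h2, pow_add, mul_left_comm]
    exact Nat.mul_le_mul (relIndex_le_pow hH hm k) ih

open MeasureTheory Filter Topology

theorem tendsto_one_div_index :
    Tendsto (fun n => ENNReal.ofReal (1 / ((levelStabilizer n).index : ℝ))) atTop (𝓝 0) := by
  rw [← ENNReal.ofReal_zero]
  refine (ENNReal.continuous_ofReal.tendsto 0).comp ?_
  refine squeeze_zero (fun _ => by positivity) (fun n => ?_) tendsto_one_div_add_atTop_nhds_zero_nat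
  refine one_div_le_one_div_of_le (by positivity) ?_
  rw [index_levelStabilizer]
  have h1 : n + 1 ≤ 2 ^ n := Nat.lt_two_pow_self
  have h2 : n < 2 ^ n - 1 + 1 := by omega
  have h3 : 2 ^ n - 1 < 2 ^ (2 ^ n - 1) := Nat.lt_two_pow_self
  exact_mod_cast (by omega : n + 1 ≤ 2 ^ (2 ^ n - 1))

theorem ediam_le_of_agree {n : ℕ} {s : Set TreeAut} (hs : ∀ g ∈ s, ∀ h ∈ s, Agree n g h) :
    Metric.ediam s ≤ ENNReal.ofReal (1 / ((levelStabilizer n).index : ℝ)) := by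
  refine Metric.ediam_le fun g hg h hh => ?_
  rw [edist_dist]
  exact ENNReal.ofReal_le_ofReal (hs g hg h hh).dist_le

/-- The cosets of `H ∩ G_n` in `H` cover `H` by sets of diameter at most `1 / [G : G_n]`, so `C`
bounds the `s`-dimensional Hausdorff measure. -/
theorem dimH_le_of_relIndex_le {H : Subgroup TreeAut} {s : NNReal} {C : ℝ}
    (h : ∀ᶠ n in atTop, ((levelStabilizer n).relIndex H : ℝ) *
      (1 / ((levelStabilizer n).index : ℝ)) ^ (s : ℝ) ≤ C) :
    dimH (H : Set TreeAut) ≤ s := by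
  borelize TreeAut
  have hfin : ∀ n, Finite (H ⧸ (levelStabilizer n).subgroupOf H) := fun n =>
    Nat.finite_of_card_ne_zero (relIndex_levelStabilizer_ne_zero n H)
  have := fun n => Fintype.ofFinite (H ⧸ (levelStabilizer n).subgroupOf H)
  refine dimH_le_of_hausdorffMeasure_ne_top (ne_top_of_le_ne_top (ENNReal.ofReal_ne_top (r := C)) ?_)
  let t : ∀ n, H ⧸ (levelStabilizer n).subgroupOf H → Set TreeAut :=
    fun n q => {g | ∃ h : H, h.1 = g ∧ (QuotientGroup.mk h : H ⧸ _) = q}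
  have ht : ∀ n q, Metric.ediam (t n q) ≤
      ENNReal.ofReal (1 / ((levelStabilizer n).index : ℝ)) := by
    intro n q
    refine ediam_le_of_agree ?_
    rintro _ ⟨g, rfl, hg⟩ _ ⟨h, rfl, hh⟩
    rw [← hh, QuotientGroup.eq] at hg
    exact agree_iff_inv_mul_mem.2 hg
  refine (Measure.hausdorffMeasure_le_liminf_sum (s : ℝ) (H : Set TreeAut) _ tendsto_one_div_index t
    (.of_forall ht) (.of_forall fun n g hg => Set.mem_iUnion.2 ⟨_, ⟨g, hg⟩, rfl, rfl⟩)).trans ?_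
  refine Filter.liminf_le_of_frequently_le (Eventually.frequently ?_)
  filter_upwards [h] with n hn
  have hpos : 0 < 1 / ((levelStabilizer n).index : ℝ) := by
    have := Nat.pos_of_ne_zero (levelStabilizer_index_ne_zero n)
    positivity
  calc ∑ q, Metric.ediam (t n q) ^ (s : ℝ)
      ≤ ∑ _q : H ⧸ (levelStabilizer n).subgroupOf H,
          ENNReal.ofReal (1 / ((levelStabilizer n).index : ℝ)) ^ (s : ℝ) :=
        Finset.sum_le_sum fun q _ => ENNReal.rpow_le_rpow (ht n q) s.2
    _ = ENNReal.ofReal (((levelStabilizer n).relIndex H : ℝ) *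
          (1 / ((levelStabilizer n).index : ℝ)) ^ (s : ℝ)) := by
        rw [Finset.sum_const, nsmul_eq_mul, Finset.card_univ, ← Nat.card_eq_fintype_card,
          ENNReal.ofReal_mul (by positivity), ENNReal.ofReal_natCast,
          ENNReal.ofReal_rpow_of_pos hpos]
        rfl
    _ ≤ ENNReal.ofReal C := ENNReal.ofReal_le_ofReal hn

theorem dimH_le_of_sec_mem {H : Subgroup TreeAut} (hH : ∀ g ∈ H, ∀ i, sec g i ∈ H) {n a : ℕ}
    (ha : (levelStabilizer (n + 1)).relIndex (H ⊓ levelStabilizer n) ≤ 2 ^ a) :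
    dimH (H : Set TreeAut) ≤ ENNReal.ofReal ((a : ℝ) / 2 ^ n) := by
  set s : NNReal := Real.toNNReal ((a : ℝ) / 2 ^ n) with hs
  have hs' : (s : ℝ) = (a : ℝ) / 2 ^ n := Real.coe_toNNReal _ (by positivity)
  -- Since `2 ^ n * s = a`, the growth `2 ^ (a * 2 ^ k)` of the number of cosets cancels against the
  -- diameters; the factor `2 ^ s` comes from the `-1` in `[G : G_N] = 2 ^ (2 ^ N - 1)`.
  refine dimH_le_of_relIndex_le (s := s) (C := (levelStabilizer n).relIndex H * 2 ^ (s : ℝ)) ?_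
  filter_upwards [eventually_ge_atTop n] with N hN
  obtain ⟨k, rfl⟩ := Nat.exists_eq_add_of_le hN
  have h1 : ((levelStabilizer (n + k)).relIndex H : ℝ) ≤
      (levelStabilizer n).relIndex H * (2 : ℝ) ^ ((a * 2 ^ k : ℕ) : ℝ) := by
    rw [Real.rpow_natCast, pow_mul]
    exact_mod_cast relIndex_levelStabilizer_le hH (by positivity) ha k
  have h2 : (1 / ((levelStabilizer (n + k)).index : ℝ)) ^ (s : ℝ) =
      (2 : ℝ) ^ (-((a * 2 ^ k : ℕ) : ℝ)) * 2 ^ (s : ℝ) := by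
    have hidx : (1 / ((levelStabilizer (n + k)).index : ℝ)) = (2 : ℝ) ^ (-((2 : ℝ) ^ (n + k) - 1)) := by
      rw [index_levelStabilizer, Real.rpow_neg zero_le_two, one_div]
      congr 1
      have h3 : ((2 : ℝ) ^ (n + k) - 1) = ((2 ^ (n + k) - 1 : ℕ) : ℝ) := by
        push_cast [Nat.one_le_two_pow]; rfl
      rw [h3, Real.rpow_natCast]
      push_cast; rfl
    rw [hidx, ← Real.rpow_mul zero_le_two, ← Real.rpow_add zero_lt_two, hs']
    congr 1
    push_cast
    rw [pow_add]
    field_simp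
    ring
  rw [h2]
  calc _ ≤ (levelStabilizer n).relIndex H * (2 : ℝ) ^ ((a * 2 ^ k : ℕ) : ℝ) *
        ((2 : ℝ) ^ (-((a * 2 ^ k : ℕ) : ℝ)) * 2 ^ (s : ℝ)) := by gcongr
    _ = _ := by
      rw [Real.rpow_neg zero_le_two]
      field_simp

/-! ### The Hausdorff dimension of the full automorphism group -/

/-- The position of a word in the bijective base 2 numeration. -/
def wordIndex : Word → ℕ
  | [] => 0
  | x :: w => 2 * wordIndex w + 1 + x.val

theorem wordIndex_injective : Function.Injective wordIndex := by
  intro u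
  induction u with
  | nil =>
    intro v h
    cases v with
    | nil => rfl
    | cons y v => simp only [wordIndex] at h; omega
  | cons x u ih =>
    intro v h
    cases v with
    | nil => simp only [wordIndex] at h; omega
    | cons y v =>
      simp only [wordIndex] at h
      have hx := ZMod.val_lt x
      have hy := ZMod.val_lt y
      rw [ih (show wordIndex u = wordIndex v by omega),
        ZMod.val_injective 2 (show x.val = y.val by omega)]

theorem wordIndex_surjective : Function.Surjective wordIndex := by
  intro k
  induction k using Nat.strong_induction_on with
  | _ k ih =>
    rcases Nat.eq_zero_or_pos k with rfl | hk
    · exact ⟨[], rfl⟩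
    · obtain ⟨w, hw⟩ := ih ((k - 1) / 2) (by omega)
      refine ⟨((k - 1 : ℕ) : Letter) :: w, ?_⟩
      rw [wordIndex, hw, ZMod.val_natCast]
      omega

theorem two_pow_le_wordIndex_add_one (w : Word) : 2 ^ w.length ≤ wordIndex w + 1 := by
  induction w with
  | nil => simp [wordIndex]
  | cons x w ih =>
    rw [List.length_cons, pow_succ, wordIndex]
    omega

/-- The bijection of the words with the natural numbers given by `wordIndex`. -/
noncomputable def wordEquiv : Word ≃ ℕ :=
  Equiv.ofBijective wordIndex ⟨wordIndex_injective, wordIndex_surjective⟩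

/-- The real number in `[0, 1]` whose binary digits are the labels of `g`. -/
noncomputable def labelReal (g : TreeAut) : ℝ :=
  Real.ofDigits (b := 2) fun k => (label g (wordEquiv.symm k) : Fin 2)

/-- `wordIndex` lists the words level by level. If the labels first differ on level `n`, the first
`2 ^ n - 1` digits agree, and `2 ^ (-(2 ^ n - 1))` is exactly the distance. -/
theorem lipschitzWith_labelReal : LipschitzWith 1 labelReal := by
  refine LipschitzWith.of_dist_le_mul fun g h => ?_
  rw [NNReal.coe_one, one_mul]
  rcases eq_or_ne g h with rfl | hne
  · simp
  have hd : dist g h = 1 / ((levelStabilizer (firstDifference g h)).index : ℝ) := if_neg hne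
  rw [hd, index_levelStabilizer, Real.dist_eq, one_div]
  push_cast
  refine Real.abs_ofDigits_sub_ofDigits_le (b := 2) fun k hk => ?_
  by_contra hc
  have hmem : (wordEquiv.symm k).length ∈
      {k | ∃ u : Word, u.length = k ∧ label g u ≠ label h u} := ⟨_, rfl, hc⟩
  have h1 : firstDifference g h ≤ (wordEquiv.symm k).length := Nat.sInf_le hmem
  have h2 := two_pow_le_wordIndex_add_one (wordEquiv.symm k)
  have h3 : wordIndex (wordEquiv.symm k) = k := wordEquiv.apply_symm_apply k
  have h4 := Nat.pow_le_pow_right zero_lt_two h1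
  omega

/-- `labelReal` is 1-Lipschitz and its range contains `[0, 1)`, by binary expansion. -/
theorem one_le_dimH_univ : 1 ≤ dimH (Set.univ : Set TreeAut) := by
  have hsub : Set.Ico (0 : ℝ) 1 ⊆ Set.range labelReal := by
    intro x hx
    refine ⟨ofLabels fun w => (Real.digits x 2 (wordEquiv w) : Fin 2), ?_⟩
    have h : labelReal (ofLabels fun w => (Real.digits x 2 (wordEquiv w) : Fin 2)) =
        Real.ofDigits (Real.digits x 2) := by
      unfold labelReal
      congr 1
      funext k
      exact (label_ofLabels _ _).trans
        (congrArg (Real.digits x 2) (wordEquiv.apply_symm_apply k))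
    rw [h]
    exact Real.ofDigits_digits one_lt_two hx
  have hIco : dimH (Set.Ico (0 : ℝ) 1) = 1 := by
    rw [Real.dimH_of_nonempty_interior (by simp)]
    simp
  calc (1 : ENNReal) = dimH (Set.Ico (0 : ℝ) 1) := hIco.symm
    _ ≤ dimH (Set.range labelReal) := dimH_mono hsub
    _ ≤ _ := lipschitzWith_labelReal.dimH_range_le

/-! ### Automorphisms whose root pattern belongs to a pattern group -/

/-- The group of the automorphisms whose pattern of size `d` at the root belongs to `P`. -/
def rootPatternGroup {d : ℕ} (P : Subgroup (FinTreeAut d)) : Subgroup TreeAut where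
  carrier := {g | ∃ p ∈ P, AppearsAt (portrait p) [] g}
  one_mem' := ⟨1, P.one_mem, fun v => by rw [label_one, portrait_one]⟩
  mul_mem' := by
    rintro g h ⟨p, hp, hpg⟩ ⟨q, hq, hqh⟩
    refine ⟨p * q, P.mul_mem hp hq, fun v => ?_⟩
    rw [label_mul, portrait_mul, map_append_of_appearsAt hqh v.1 v.2.le, hqh v, map_nil]
    exact congrArg (· + portrait q v) (hpg (innerMap q v))
  inv_mem' := by
    rintro g ⟨p, hp, hpg⟩
    refine ⟨p⁻¹, P.inv_mem hp, fun v => ?_⟩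
    have key : g⁻¹ v.1 = (innerMap p⁻¹ v).1 := by
      apply g.injective
      have h := map_append_of_appearsAt hpg _ (innerMap p⁻¹ v).2.le
      rw [List.nil_append, map_nil, List.nil_append] at h
      rw [h, RelIso.apply_inv_self]
      have : p ⟨(innerMap p⁻¹ v).1, (innerMap p⁻¹ v).2.le⟩ = v.toFin :=
        RelIso.apply_inv_self p v.toFin
      rw [this]
      rfl
    rw [List.nil_append, label_inv, portrait_inv, key]
    exact hpg (innerMap p⁻¹ v)

variable {d : ℕ} {P : Subgroup (FinTreeAut d)}

theorem mem_rootPatternGroup_of_agree {g h : TreeAut} (H : Agree d g h)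
    (hg : g ∈ rootPatternGroup P) : h ∈ rootPatternGroup P := by
  obtain ⟨p, hp, hpg⟩ := hg
  exact ⟨p, hp, fun v => (H v.1 v.2).symm.trans (hpg v)⟩

theorem mem_finitelyConstrainedGroup_iff {g : TreeAut} :
    g ∈ finitelyConstrainedGroup P ↔
      g ∈ rootPatternGroup P ∧ ∀ i, sec g i ∈ finitelyConstrainedGroup P := by
  have hmem : ∀ g : TreeAut, g ∈ finitelyConstrainedGroup P ↔
      ∀ w : Word, ∃ p ∈ P, AppearsAt (portrait p) w g := fun g =>
    mem_treeSubshift_compl.trans (by simp)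
  have hsec : ∀ (i : Letter) (w : Word) (p : FinTreeAut d),
      AppearsAt (portrait p) w (sec g i) ↔ AppearsAt (portrait p) (i :: w) g := fun i w p => by
    simp [AppearsAt]
  simp only [hmem, hsec]
  exact ⟨fun H => ⟨H [], fun i w => H (i :: w)⟩, fun H w => by
    cases w with
    | nil => exact H.1
    | cons i w => exact H.2 i w⟩

theorem finitelyConstrainedGroup_le : finitelyConstrainedGroup P ≤ rootPatternGroup P :=
  fun _ hg => (mem_finitelyConstrainedGroup_iff.1 hg).1

theorem sec_mem_finitelyConstrainedGroup (g : TreeAut) (hg : g ∈ finitelyConstrainedGroup P)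
    (i : Letter) : sec g i ∈ finitelyConstrainedGroup P :=
  (mem_finitelyConstrainedGroup_iff.1 hg).2 i

/-- Coinduction principle: every section-closed subset of `rootPatternGroup P` lies in `G_P`. -/
theorem mem_finitelyConstrainedGroup_of_forall {S : Set TreeAut}
    (hS : S ⊆ rootPatternGroup P) (hsec : ∀ g ∈ S, ∀ i, sec g i ∈ S) {g : TreeAut} (hg : g ∈ S) :
    g ∈ finitelyConstrainedGroup P := by
  refine mem_treeSubshift_compl.2 fun w => ?_
  induction w generalizing g with
  | nil =>
    obtain ⟨p, hp, hpg⟩ := hS hg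
    exact ⟨_, ⟨p, hp, rfl⟩, hpg⟩
  | cons i w ih =>
    obtain ⟨p, hp, hpw⟩ := ih (hsec g hg i)
    exact ⟨p, hp, fun v => by simpa using hpw v⟩

open Classical in
theorem exists_agree_sec_of_isEssential {d : ℕ} {P : Subgroup (FinTreeAut (d + 1))}
    (hP : IsEssential P) {g : TreeAut} (hg : g ∈ rootPatternGroup P) (i : Letter) :
    ∃ h ∈ rootPatternGroup P, Agree d h (sec g i) := by
  obtain ⟨p, hp, hpg⟩ := hg
  obtain ⟨q, hq, hqp⟩ := hP p hp i
  refine ⟨ofLabels fun w => if hw : w.length < d + 1 then portrait q ⟨w, hw⟩ else 0,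
    ⟨q, hq, fun v => ?_⟩, fun u hu => ?_⟩
  · rw [List.nil_append, label_ofLabels, dif_pos v.2]
  · have hu' : (i :: u).length < d + 1 := by simpa using hu
    rw [label_ofLabels, dif_pos (by omega), label_sec, hqp u hu']
    exact (hpg ⟨i :: u, hu'⟩).symm

/-! ### Pattern groups of maximal Hausdorff dimension have index two -/

theorem levelStabilizer_le_rootPatternGroup {d : ℕ} (P : Subgroup (FinTreeAut d)) :
    levelStabilizer d ≤ rootPatternGroup P := fun _ hg =>
  mem_rootPatternGroup_of_agree (mem_levelStabilizer.1 hg).symm (rootPatternGroup P).one_mem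

theorem relIndex_dvd_two_of_lt_dimH {n : ℕ} {P : Subgroup (FinTreeAut (n + 1))}
    (h : ENNReal.ofReal (1 - 2 / 2 ^ n) < dimH (finitelyConstrainedGroup P : Set TreeAut)) :
    (rootPatternGroup P).relIndex (levelStabilizer n) ∣ 2 := by
  have hmul := Subgroup.relIndex_mul_relIndex (levelStabilizer (n + 1))
    (rootPatternGroup P ⊓ levelStabilizer n) (levelStabilizer n)
    (le_inf (levelStabilizer_le_rootPatternGroup P)
      (levelStabilizer_antitone (Nat.le_add_right n 1))) inf_le_right
  rw [Subgroup.inf_relIndex_right, relIndex_levelStabilizer_succ] at hmul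
  -- The index of `Q` in `G_n` divides `[G_n : G_{n+1}] = 2 ^ 2 ^ n`, so it is a power of two and
  -- only exponents at least 2 must be excluded.
  obtain ⟨k, hk, hQ⟩ := (Nat.dvd_prime_pow Nat.prime_two).1 (Dvd.intro_left _ hmul)
  rcases Nat.lt_or_ge k 2 with hk2 | hk2
  · rw [hQ]
    exact pow_dvd_pow 2 (show k ≤ 1 by omega)
  · exfalso
    have hpow : 2 ^ 2 ^ n = 2 ^ (2 ^ n - k) * 2 ^ k := by rw [← pow_add, Nat.sub_add_cancel hk]
    rw [hQ, hpow] at hmul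
    have h1 : (levelStabilizer (n + 1)).relIndex (rootPatternGroup P ⊓ levelStabilizer n) =
        2 ^ (2 ^ n - k) := Nat.eq_of_mul_eq_mul_right (by positivity) hmul
    have h2 : (levelStabilizer (n + 1)).relIndex
        (finitelyConstrainedGroup P ⊓ levelStabilizer n) ≤ 2 ^ (2 ^ n - 2) :=
      calc _ ≤ _ := Subgroup.relIndex_le_of_le_right
            (inf_le_inf_right _ finitelyConstrainedGroup_le) (relIndex_levelStabilizer_ne_zero _ _)
        _ = _ := h1
        _ ≤ _ := Nat.pow_le_pow_right zero_lt_two (by omega)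
    refine absurd (dimH_le_of_sec_mem sec_mem_finitelyConstrainedGroup h2) (not_le.2 ?_)
    convert h using 2
    rw [Nat.cast_sub (hk2.trans hk)]
    push_cast
    field_simp

theorem mul_mem_of_relIndex_dvd_two {G : Type*} [Group G] {Q B : Subgroup G}
    (h : Q.relIndex B ∣ 2) {a b : G} (ha : a ∈ B) (hb : b ∈ B) (haQ : a ∉ Q) (hbQ : b ∉ Q) :
    a * b ∈ Q := by
  rcases (Nat.dvd_prime Nat.prime_two).1 h with h1 | h2
  · exact absurd (Subgroup.relIndex_eq_one.1 h1 ha) haQ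
  · have := Subgroup.mul_mem_iff_of_index_two (H := Q.subgroupOf B) h2 (a := ⟨a, ha⟩) (b := ⟨b, hb⟩)
    simp only [Subgroup.mem_subgroupOf, haQ, hbQ, iff_self, iff_true] at this
    exact this

/-! ### Essentiality: from index at most two in a level stabilizer to index at most two in `G` -/

section

variable {e : ℕ} {Q : Subgroup TreeAut}

theorem exists_agree_of_mem_levelStabilizer
    (hess : ∀ g ∈ Q, ∀ i, ∃ h ∈ Q, Agree (e + 1) h (sec g i))
    (hQ : ∀ a ∈ levelStabilizer (e + 1), ∀ b ∈ levelStabilizer (e + 1), a ∉ Q → b ∉ Q → a * b ∈ Q)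
    {g : TreeAut} (hg : g ∈ levelStabilizer e) : ∃ h ∈ Q, Agree (e + 1) h g := by
  -- If `a` is not realized as a section at 0 and `b` not at 1, then `(a, 1)` and `(1, b)` are
  -- outside `Q`; their product `(a, b)` is in `Q` and realizes `a` at 0.
  have key : ∃ i, ∀ g ∈ levelStabilizer e, ∃ h ∈ Q, Agree (e + 1) (sec h i) g := by
    by_contra! hc
    obtain ⟨a, ha, ha'⟩ := hc 0
    obtain ⟨b, hb, hb'⟩ := hc 1
    have h0 : branch 0 (Pi.mulSingle 0 a) ∉ Q := fun h => by
      refine ha' _ h ?_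
      rw [sec_branch, Pi.mulSingle_eq_same]
      exact Agree.refl _ _
    have h1 : branch 0 (Pi.mulSingle 1 b) ∉ Q := fun h => by
      refine hb' _ h ?_
      rw [sec_branch, Pi.mulSingle_eq_same]
      exact Agree.refl _ _
    refine ha' _ (hQ _ (branch_mulSingle_mem_levelStabilizer ha 0) _
      (branch_mulSingle_mem_levelStabilizer hb 1) h0 h1) ?_
    rw [branch_mul_branch_zero, sec_branch]
    simp [Agree.refl]
  obtain ⟨i, hi⟩ := key
  obtain ⟨h, hh, hag⟩ := hi g hg
  obtain ⟨k, hk, hkh⟩ := hess h hh i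
  exact ⟨k, hk, hkh.trans hag⟩

/-- Descent on the level: `(g, 1)` stabilizes one level more than `g`, so some `h ∈ Q` approximates
it. By essentiality the section of `h` at 0 yields an element of `Q` agreeing with `g` below level
`e`, and the previous lemma corrects the remaining level. -/
theorem exists_agree_mem
    (hess : ∀ g ∈ Q, ∀ i, ∃ h ∈ Q, Agree (e + 1) h (sec g i))
    (hQ : ∀ a ∈ levelStabilizer (e + 1), ∀ b ∈ levelStabilizer (e + 1), a ∉ Q → b ∉ Q → a * b ∈ Q)
    (g : TreeAut) : ∃ h ∈ Q, Agree (e + 1) h g := by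
  suffices H : ∀ k ≤ e, ∀ g ∈ levelStabilizer (e - k), ∃ h ∈ Q, Agree (e + 1) h g by
    refine H e le_rfl g ?_
    rw [Nat.sub_self, levelStabilizer_zero]
    exact Subgroup.mem_top g
  intro k
  induction k with
  | zero => exact fun _ g hg => exists_agree_of_mem_levelStabilizer hess hQ hg
  | succ k ih =>
    intro hk g hg
    have hmem := branch_mulSingle_mem_levelStabilizer hg 0
    rw [show e - (k + 1) + 1 = e - k by omega] at hmem
    obtain ⟨h, hh, hag⟩ := ih (by omega) _ hmem
    have h1 := (agree_succ_iff.1 hag).2 0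
    rw [sec_branch, Pi.mulSingle_eq_same] at h1
    obtain ⟨h', hh', hag'⟩ := hess h hh 0
    have h2 : Agree e h' g := (hag'.mono (Nat.le_succ e)).trans h1
    obtain ⟨q, hq, hqa⟩ :=
      exists_agree_of_mem_levelStabilizer hess hQ (agree_iff_inv_mul_mem.1 h2)
    refine ⟨h' * q, Q.mul_mem hh' hq, ?_⟩
    simpa using (Agree.refl (e + 1) h').mul hqa

theorem mul_mem_of_notMem
    (hess : ∀ g ∈ Q, ∀ i, ∃ h ∈ Q, Agree (e + 1) h (sec g i))
    (hQ : ∀ a ∈ levelStabilizer (e + 1), ∀ b ∈ levelStabilizer (e + 1), a ∉ Q → b ∉ Q → a * b ∈ Q)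
    {a b : TreeAut} (ha : a ∉ Q) (hb : b ∉ Q) : a * b ∈ Q := by
  obtain ⟨q, hq, hqa⟩ := exists_agree_mem hess hQ a
  -- Approximating `b⁻¹` rather than `b` puts `b * r` in the stabilizer, so that `a * b = q * ((q⁻¹
  -- * a) * (b * r)) * r⁻¹`.
  obtain ⟨r, hr, hrb⟩ := exists_agree_mem hess hQ b⁻¹
  rw [agree_iff_inv_mul_mem] at hqa hrb
  have h := hQ _ hqa _ (inv_mem hrb)
    (fun h => ha ((Q.mul_mem_cancel_left (inv_mem hq)).1 h))
    (fun h => hb (by simpa [Q.mul_mem_cancel_right hr] using h))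
  have h2 := Q.mul_mem (Q.mul_mem hq h) (inv_mem hr)
  simpa [mul_assoc] using h2

end

theorem exists_character {G : Type*} [Group G] {Q : Subgroup G}
    (hQ : ∀ a b, a ∉ Q → b ∉ Q → a * b ∈ Q) :
    ∃ χ : G → ZMod 2, (∀ g h, χ (g * h) = χ g + χ h) ∧ ∀ g, χ g = 0 ↔ g ∈ Q := by
  classical
  refine ⟨fun g => if g ∈ Q then 0 else 1, fun g h => ?_, fun g => by simp⟩
  by_cases hg : g ∈ Q <;> by_cases hh : h ∈ Q
  · simp [hg, hh, Q.mul_mem hg hh]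
  · simp [hg, hh, Q.mul_mem_cancel_left hg]
  · simp [hg, hh, Q.mul_mem_cancel_right hh]
  · simp only [hg, hh, hQ g h hg hh, if_true, if_false]
    decide

/-! ### Homomorphisms from a finitely constrained group to the cyclic group of order four -/

/-- The restriction of `χ` to the automorphisms supported on the subtree of the letter `0`. -/
def halfChar (χ : TreeAut → ZMod 2) (g : TreeAut) : ZMod 2 := χ (branch 0 (Pi.mulSingle 0 g))

/-- The `ZMod 4`-valued homomorphism of level `n` attached to the character `χ`. -/
def levelChar (χ : TreeAut → ZMod 2) : ℕ → TreeAut → ZMod 4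
  | 0, g => 2 * ((halfChar χ (sec g 0)).val : ZMod 4) +
      ((χ (branch 1 1)).val : ZMod 4) * ((label g []).val : ZMod 4)
  | n + 1, g => levelChar χ n (sec g 0) + levelChar χ n (sec g 1)

theorem char_one {G : Type*} [Group G] {χ : G → ZMod 2} (hχ : ∀ g h, χ (g * h) = χ g + χ h) :
    χ 1 = 0 := by simpa using hχ 1 1

theorem halfChar_mul {χ : TreeAut → ZMod 2} (hχ : ∀ g h, χ (g * h) = χ g + χ h)
    (g h : TreeAut) : halfChar χ (g * h) = halfChar χ g + halfChar χ h := by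
  rw [halfChar, halfChar, halfChar, ← hχ, branch_mul_branch_zero, Pi.mulSingle_mul]

theorem halfChar_one {χ : TreeAut → ZMod 2} (hχ : ∀ g h, χ (g * h) = χ g + χ h) :
    halfChar χ 1 = 0 := char_one (halfChar_mul hχ)

/-- The root swap conjugates `(g, 1)` to `(1, g)`, and `χ` has abelian target. -/
theorem char_branch_mulSingle_one {χ : TreeAut → ZMod 2}
    (hχ : ∀ g h, χ (g * h) = χ g + χ h) (g : TreeAut) :
    χ (branch 0 (Pi.mulSingle 1 g)) = halfChar χ g := by
  have h : branch 0 (Pi.mulSingle 1 g) * branch 1 1 = branch 1 1 * branch 0 (Pi.mulSingle 0 g) := by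
    refine ext_sec (by simp [label_mul, map_nil]) fun i => ?_
    have hi : ∀ i : Letter, i = 0 ∨ i = 1 := by decide
    have h2 : (1 + 1 : Letter) = 0 := by decide
    rcases hi i with rfl | rfl <;> simp [sec_mul, h2]
  have h1 := congrArg χ h
  rw [hχ, hχ, add_comm] at h1
  exact add_left_cancel h1

theorem char_eq {χ : TreeAut → ZMod 2} (hχ : ∀ g h, χ (g * h) = χ g + χ h) (g : TreeAut) :
    χ g = label g [] * χ (branch 1 1) + halfChar χ (sec g 0) + halfChar χ (sec g 1) := by
  have hg : g = branch (label g []) 1 * branch 0 (Pi.mulSingle 0 (sec g 0)) *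
      branch 0 (Pi.mulSingle 1 (sec g 1)) := by
    rw [branch_mul_branch_zero, branch_mul_branch_zero]
    refine ext_sec (by simp) fun i => ?_
    have hi : ∀ i : Letter, i = 0 ∨ i = 1 := by decide
    rcases hi i with rfl | rfl <;> simp
  have h0 : ∀ a : Letter, χ (branch a 1) = a * χ (branch 1 1) := by
    intro a
    have ha : ∀ a : Letter, a = 0 ∨ a = 1 := by decide
    rcases ha a with rfl | rfl
    · rw [branch_zero_one, char_one hχ, zero_mul]
    · rw [one_mul]
  conv_lhs => rw [hg]
  rw [hχ, hχ, h0, char_branch_mulSingle_one hχ]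
  rfl

/-- Here `e` is `χ` of the root swap, `l`, `k` are root labels and `a`, `a'` the values of `halfChar
χ` at the two sections of the left factor. For `k = 1`, replacing `a` by `a' = a + l * e` adds `2 *
l * e` modulo 4, which cancels the carry `-2 * l * e` of `l + k`. -/
theorem val_add_carry : ∀ a a' e l b k : ZMod 2, l * e + a + a' = 0 →
    2 * (((if k = 0 then a else a') + b).val : ZMod 4) + (e.val : ZMod 4) * ((l + k).val : ZMod 4) =
      (2 * (a.val : ZMod 4) + (e.val : ZMod 4) * (l.val : ZMod 4)) +
        (2 * (b.val : ZMod 4) + (e.val : ZMod 4) * (k.val : ZMod 4)) := by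
  decide

theorem levelChar_mul {χ : TreeAut → ZMod 2} (hχ : ∀ g h, χ (g * h) = χ g + χ h)
    {H : Subgroup TreeAut} (hH : ∀ g ∈ H, ∀ i, sec g i ∈ H) (hχH : ∀ g ∈ H, χ g = 0) (n : ℕ) :
    ∀ g ∈ H, ∀ h ∈ H, levelChar χ n (g * h) = levelChar χ n g + levelChar χ n h := by
  induction n with
  | zero =>
    intro g hg h _
    have h0 := hχH g hg
    rw [char_eq hχ] at h0
    have h1 : halfChar χ (sec g (0 + label h [])) =
        if label h [] = 0 then halfChar χ (sec g 0) else halfChar χ (sec g 1) := by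
      have ha : ∀ a : Letter, a = 0 ∨ a = 1 := by decide
      rcases ha (label h []) with h2 | h2 <;> simp [h2]
    rw [levelChar, levelChar, levelChar, sec_mul, halfChar_mul hχ, label_mul, map_nil, h1]
    exact val_add_carry _ _ _ _ _ _ h0
  | succ n ih =>
    intro g hg h hh
    rw [levelChar, levelChar, levelChar, sec_mul, sec_mul, ih _ (hH g hg _) _ (hH h hh _),
      ih _ (hH g hg _) _ (hH h hh _)]
    -- The root label of `h` at most exchanges the two sections of `g`, which leaves their sum
    -- unchanged.
    have ha : ∀ a : Letter, a = 0 ∨ a = 1 := by decide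
    have h2 : (1 + 1 : Letter) = 0 := by decide
    rcases ha (label h []) with h3 | h3 <;> simp only [h3, add_zero, zero_add, h2] <;> ring

/-- `levelChar χ n` as a homomorphism on a self-similar group in the kernel of `χ`. -/
def levelCharHom {χ : TreeAut → ZMod 2} (hχ : ∀ g h, χ (g * h) = χ g + χ h)
    {H : Subgroup TreeAut} (hH : ∀ g ∈ H, ∀ i, sec g i ∈ H) (hχH : ∀ g ∈ H, χ g = 0) (n : ℕ) :
    H →* Multiplicative (ZMod 4) :=
  MonoidHom.mk' (fun g => Multiplicative.ofAdd (levelChar χ n g)) fun g h =>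
    congrArg Multiplicative.ofAdd (levelChar_mul hχ hH hχH n g g.2 h h.2)

theorem halfChar_eq_of_agree {χ : TreeAut → ZMod 2} {d : ℕ}
    (hχd : ∀ g h, Agree (d + 1) g h → χ g = χ h) {g h : TreeAut} (H : Agree d g h) :
    halfChar χ g = halfChar χ h := by
  refine hχd _ _ (agree_succ_iff.2 ⟨by simp, fun i => ?_⟩)
  rw [sec_branch, sec_branch]
  rcases eq_or_ne i 0 with rfl | hi
  · simpa using H
  · simpa [hi] using Agree.refl d 1

theorem levelChar_eq_of_agree {χ : TreeAut → ZMod 2} {d : ℕ}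
    (hχd : ∀ g h, Agree (d + 1) g h → χ g = χ h) (n : ℕ) :
    ∀ g h : TreeAut, Agree (d + n + 1) g h → levelChar χ n g = levelChar χ n h := by
  induction n with
  | zero =>
    intro g h H
    obtain ⟨h0, hs⟩ := agree_succ_iff.1 H
    rw [levelChar, levelChar, h0, halfChar_eq_of_agree hχd (hs 0)]
  | succ n ih =>
    intro g h H
    obtain ⟨_, hs⟩ := agree_succ_iff.1 H
    rw [levelChar, levelChar, ih _ _ (hs 0), ih _ _ (hs 1)]

/-! ### Topologically finitely generated groups -/

/-- A topologically finitely generated group has only finitely many homomorphisms to a given finite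
group that depend on finitely many levels. -/
theorem IsTopologicallyFG.exists_eq {H : Subgroup TreeAut} (hH : IsTopologicallyFG H) {M : Type*}
    [Group M] [Finite M] (f : ℕ → H →* M)
    (hf : ∀ n, ∃ N, ∀ g h : H, Agree N g.1 h.1 → f n g = f n h) :
    ∃ m n, m < n ∧ f m = f n := by
  obtain ⟨K, ⟨S, hS⟩, hK⟩ := hH
  have hKH : (K : Set TreeAut) ⊆ H := hK ▸ subset_closure
  have hSH : (S : Set TreeAut) ⊆ H := (hS ▸ Subgroup.subset_closure).trans hKH
  -- Pigeonhole: there are only finitely many maps from the finite generating set `S` to `M`.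
  obtain ⟨m, n, hne, hmn⟩ := Finite.exists_ne_map_eq_of_infinite
    fun n : ℕ => fun s : S => f n ⟨s.1, hSH s.2⟩
  have hKeq : ∀ k (hk : k ∈ K), f m ⟨k, hKH hk⟩ = f n ⟨k, hKH hk⟩ := by
    subst hS
    intro k hk
    induction hk using Subgroup.closure_induction with
    | mem x hx => exact congrFun hmn ⟨x, hx⟩
    | one => exact (map_one (f m)).trans (map_one (f n)).symm
    | mul x y hx hy ihx ihy =>
      exact (map_mul (f m) ⟨x, hKH hx⟩ ⟨y, hKH hy⟩).trans
        ((congrArg₂ (· * ·) ihx ihy).trans (map_mul (f n) ⟨x, hKH hx⟩ ⟨y, hKH hy⟩).symm)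
    | inv x hx ihx =>
      exact (map_inv (f m) ⟨x, hKH hx⟩).trans
        ((congrArg (·⁻¹) ihx).trans (map_inv (f n) ⟨x, hKH hx⟩).symm)
  have heq : f m = f n := by
    ext g
    obtain ⟨N₁, hN₁⟩ := hf m
    obtain ⟨N₂, hN₂⟩ := hf n
    have hg : g.1 ∈ closure (K : Set TreeAut) := hK ▸ g.2
    have hpos : 0 < 1 / ((levelStabilizer (max N₁ N₂)).index : ℝ) := by
      have := Nat.pos_of_ne_zero (levelStabilizer_index_ne_zero (max N₁ N₂))
      positivity
    obtain ⟨k, hk, hdist⟩ := Metric.mem_closure_iff.1 hg _ hpos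
    have hag := agree_of_dist_lt hdist
    rw [hN₁ g ⟨k, hKH hk⟩ (hag.mono (le_max_left _ _)), hKeq k hk,
      hN₂ g ⟨k, hKH hk⟩ (hag.mono (le_max_right _ _))]
  rcases hne.lt_or_gt with h | h
  · exact ⟨m, n, h, heq⟩
  · exact ⟨n, m, h, heq.symm⟩

/-! ### Extension of patterns -/

/-- The labels of the automorphism with state `q` when `f q i` is the state of its section at
`i`. -/
def extendLabel (f : TreeAut → Letter → TreeAut) : TreeAut → Word → Letter
  | q, [] => label q []
  | q, i :: w => extendLabel f (f q i) w

theorem sec_ofLabels_extendLabel (f : TreeAut → Letter → TreeAut) (q : TreeAut) (i : Letter) :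
    sec (ofLabels (extendLabel f q)) i = ofLabels (extendLabel f (f q i)) :=
  ext_label fun u => by rw [label_sec, label_ofLabels, label_ofLabels, extendLabel]

/-- Starting from `q`, each section is recursively replaced by an element of `Q` with the same
labels below level `d`. A replacement at a child alters only labels at relative depth at least `d +
1` from the parent, so every pattern of size `d + 1` stays allowed. -/
theorem exists_mem_finitelyConstrainedGroup_agree {d : ℕ} {P : Subgroup (FinTreeAut (d + 1))}
    (hP : ∀ g, ∃ q ∈ rootPatternGroup P, Agree d q g) {q : TreeAut}
    (hq : q ∈ rootPatternGroup P) : ∃ g ∈ finitelyConstrainedGroup P, Agree (d + 1) g q := by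
  choose r hr hrg using hP
  let f : TreeAut → Letter → TreeAut := fun q i => r (sec q i)
  have hag : ∀ n ≤ d + 1, ∀ q, Agree n (ofLabels (extendLabel f q)) q := by
    intro n
    induction n with
    | zero => exact fun _ _ => agree_zero _ _
    | succ n ih =>
      intro hn q
      refine agree_succ_iff.2 ⟨by rw [label_ofLabels, extendLabel], fun i => ?_⟩
      rw [sec_ofLabels_extendLabel]
      exact (ih (by omega) _).trans ((hrg (sec q i)).mono (by omega))
  refine ⟨_, mem_finitelyConstrainedGroup_of_forall
    (S := {g | ∃ q ∈ rootPatternGroup P, g = ofLabels (extendLabel f q)}) ?_ ?_ ⟨q, hq, rfl⟩,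
    hag _ le_rfl q⟩
  · rintro _ ⟨q, hq, rfl⟩
    exact mem_rootPatternGroup_of_agree (hag _ le_rfl q).symm hq
  · rintro _ ⟨q, hq, rfl⟩ i
    exact ⟨_, hr _, sec_ofLabels_extendLabel f q i⟩

/-! ### Elements separating the homomorphisms of different levels -/

/-- The automorphism with section `g` at the vertex `0 ⋯ 0` of level `n` and trivial labels outside
the subtree of this vertex. -/
def atZeros (g : TreeAut) : ℕ → TreeAut
  | 0 => g
  | n + 1 => branch 0 (Pi.mulSingle 0 (atZeros g n))

theorem atZeros_mem_levelStabilizer {g : TreeAut} {k : ℕ} (hg : g ∈ levelStabilizer k) (n : ℕ) :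
    atZeros g n ∈ levelStabilizer (k + n) := by
  induction n with
  | zero => exact hg
  | succ n ih => exact branch_mulSingle_mem_levelStabilizer ih 0

theorem atZeros_mem_finitelyConstrainedGroup {d : ℕ} {P : Subgroup (FinTreeAut (d + 1))}
    {g : TreeAut} (hg : g ∈ finitelyConstrainedGroup P) (hgd : g ∈ levelStabilizer d) (n : ℕ) :
    atZeros g n ∈ finitelyConstrainedGroup P := by
  induction n with
  | zero => exact hg
  | succ n ih =>
    refine mem_finitelyConstrainedGroup_iff.2 ⟨levelStabilizer_le_rootPatternGroup P
      (levelStabilizer_antitone (by omega : d + 1 ≤ d + (n + 1))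
        (atZeros_mem_levelStabilizer hgd (n + 1))), fun i => ?_⟩
    rw [atZeros, sec_branch]
    rcases eq_or_ne i 0 with rfl | hi
    · simpa using ih
    · simp [hi]

theorem levelChar_one {χ : TreeAut → ZMod 2} (hχ : ∀ g h, χ (g * h) = χ g + χ h) (n : ℕ) :
    levelChar χ n 1 = 0 := by
  induction n with
  | zero => simp [levelChar, label_one, halfChar_one hχ]
  | succ n ih => simp [levelChar, ih]

theorem levelChar_atZeros_add {χ : TreeAut → ZMod 2} (hχ : ∀ g h, χ (g * h) = χ g + χ h)
    (g : TreeAut) (n k : ℕ) : levelChar χ n (atZeros g (k + n)) = levelChar χ 0 (atZeros g k) := by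
  induction n with
  | zero => rfl
  | succ n ih =>
    rw [← ih, ← add_assoc, atZeros, levelChar, sec_branch, sec_branch, Pi.mulSingle_eq_same,
      Pi.mulSingle_eq_of_ne (by decide), levelChar_one hχ, add_zero]

theorem not_isTopologicallyFG_of_character {e : ℕ} {P : Subgroup (FinTreeAut (e + 2))}
    (hP : ∀ g, ∃ q ∈ rootPatternGroup P, Agree (e + 1) q g) (htop : rootPatternGroup P ≠ ⊤)
    {χ : TreeAut → ZMod 2} (hχ : ∀ g h, χ (g * h) = χ g + χ h)
    (hker : ∀ g, χ g = 0 ↔ g ∈ rootPatternGroup P) :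
    ¬ IsTopologicallyFG (finitelyConstrainedGroup P) := by
  have hχd : ∀ g h, Agree (e + 2) g h → χ g = χ h := by
    intro g h H
    have h1 := hχ g (g⁻¹ * h)
    rw [(hker _).2 (levelStabilizer_le_rootPatternGroup P (agree_iff_inv_mul_mem.1 H)),
      mul_inv_cancel_left, add_zero] at h1
    exact h1.symm
  obtain ⟨b, hb, hbQ⟩ : ∃ b ∈ levelStabilizer (e + 1), χ b ≠ 0 := by
    by_contra! hc
    refine htop (eq_top_iff.2 fun g _ => ?_)
    obtain ⟨q, hq, hqg⟩ := hP g
    have h1 := (hker _).1 (hc _ (agree_iff_inv_mul_mem.1 hqg))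
    simpa using (rootPatternGroup P).mul_mem hq h1
  obtain ⟨δ, hδ, hδχ⟩ : ∃ δ ∈ levelStabilizer e, halfChar χ δ ≠ 0 := by
    by_contra! hc
    obtain ⟨h0, hs⟩ := mem_levelStabilizer_succ.1 hb
    exact hbQ (by rw [char_eq hχ, h0, hc _ (hs 0), hc _ (hs 1)]; simp)
  have hδ1 : halfChar χ δ = 1 := by
    generalize halfChar χ δ = a at hδχ
    revert a; decide
  -- Doubling `δ` kills `χ`, since `1 + 1 = 0` in `ZMod 2`, while `levelChar χ 0` reads only the
  -- section at 0 and gives 2.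
  have hδQ : branch 0 (fun _ => δ) ∈ rootPatternGroup P := by
    rw [← hker, char_eq hχ]
    simp only [label_branch_nil, sec_branch, hδ1]
    simp
    decide
  obtain ⟨γ, hγ, hγδ⟩ := exists_mem_finitelyConstrainedGroup_agree hP hδQ
  obtain ⟨hγ0, hγs⟩ := agree_succ_iff.1 hγδ
  have hγe : γ ∈ levelStabilizer (e + 1) :=
    mem_levelStabilizer.2 ((hγδ.mono (Nat.le_succ _)).trans
      (mem_levelStabilizer.1 (branch_zero_mem_levelStabilizer fun _ => hδ)))
  have hlevel0 : levelChar χ 0 γ = 2 := by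
    rw [levelChar, hγ0, halfChar_eq_of_agree hχd (hγs 0), sec_branch, hδ1, label_branch_nil]
    simp only [ZMod.val_zero, Nat.cast_zero, mul_zero, add_zero]
    decide
  intro hfg
  obtain ⟨n, m, hnm, heq⟩ := hfg.exists_eq
    (levelCharHom hχ sec_mem_finitelyConstrainedGroup
      fun g hg => (hker g).2 (finitelyConstrainedGroup_le hg))
    fun n => ⟨e + 1 + n + 1, fun g h H =>
      congrArg Multiplicative.ofAdd (levelChar_eq_of_agree hχd n _ _ H)⟩
  have h1 : levelChar χ n (atZeros γ m) = levelChar χ m (atZeros γ m) :=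
    DFunLike.congr_fun heq ⟨_, atZeros_mem_finitelyConstrainedGroup hγ hγe m⟩
  obtain ⟨k, rfl⟩ := Nat.exists_eq_add_of_lt hnm
  have h2 : levelChar χ (n + k + 1) (atZeros γ (n + k + 1)) = 2 := by
    have := levelChar_atZeros_add hχ γ (n + k + 1) 0
    rw [zero_add] at this
    rw [this]
    exact hlevel0
  -- The level-`n` section is `γ` placed `k + 1` levels lower, too deep for `halfChar χ`, which
  -- depends only on the labels below level `e + 1`.
  have h3 : levelChar χ n (atZeros γ (n + k + 1)) = 0 := by
    have hmem := atZeros_mem_levelStabilizer hγe k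
    rw [show n + k + 1 = (k + 1) + n by omega, levelChar_atZeros_add hχ, levelChar, atZeros,
      label_branch_nil, sec_branch, Pi.mulSingle_eq_same,
      halfChar_eq_of_agree hχd ((mem_levelStabilizer.1 hmem).mono (Nat.le_add_right _ k)),
      halfChar_one hχ]
    simp
  rw [h2, h3] at h1
  exact absurd h1 (by decide)

end BinaryTree

/-- A finitely constrained group of binary rooted tree automorphisms that is defined by an essential
pattern group of size `d ≥ 2` and has Hausdorff dimension `1 - 1 / 2 ^ (d - 1)` is not
topologically finitely generated. -/
theorem theorem2 (d : ℕ) (hd : 2 ≤ d) (P : Subgroup (BinaryTree.FinTreeAut d))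
    (hP : BinaryTree.IsEssential P)
    (hdim : dimH (BinaryTree.finitelyConstrainedGroup P : Set BinaryTree.TreeAut) =
      ENNReal.ofReal (1 - 1 / 2 ^ (d - 1))) :
    ¬ BinaryTree.IsTopologicallyFG (BinaryTree.finitelyConstrainedGroup P) := by
  obtain ⟨e, rfl⟩ := Nat.exists_eq_add_of_le' hd
  rw [show e + 2 - 1 = e + 1 by omega] at hdim
  have hpow : (2 : ℝ) ≤ 2 ^ (e + 1) := by
    simpa using pow_le_pow_right₀ (one_le_two (α := ℝ)) (Nat.le_add_left 1 e)
  have hinv : 0 < 1 / (2 : ℝ) ^ (e + 1) := by positivity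
  -- Strict positivity of the dimension is needed because `ENNReal.ofReal` truncates at 0.
  have hinv' : 1 / (2 : ℝ) ^ (e + 1) < 1 :=
    (div_lt_one (by positivity)).2 (lt_of_lt_of_le one_lt_two hpow)
  have hindex := BinaryTree.relIndex_dvd_two_of_lt_dimH (n := e + 1) (P := P) (by
    rw [hdim, ENNReal.ofReal_lt_ofReal_iff (by linarith)]
    have : (2 : ℝ) / 2 ^ (e + 1) = 2 * (1 / 2 ^ (e + 1)) := by ring
    linarith)
  have htop : BinaryTree.rootPatternGroup P ≠ ⊤ := by
    intro h
    have huniv : (BinaryTree.finitelyConstrainedGroup P : Set BinaryTree.TreeAut) = Set.univ :=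
      Set.eq_univ_of_forall fun g => BinaryTree.mem_finitelyConstrainedGroup_of_forall
        (S := Set.univ) (by simp [h]) (fun _ _ _ => Set.mem_univ _) (Set.mem_univ g)
    have h1 := BinaryTree.one_le_dimH_univ
    rw [← huniv, hdim, ENNReal.one_le_ofReal] at h1
    linarith
  have hess := fun g hg => BinaryTree.exists_agree_sec_of_isEssential hP (g := g) hg
  have hQ := fun a ha b hb =>
    BinaryTree.mul_mem_of_relIndex_dvd_two hindex (a := a) (b := b) ha hb
  obtain ⟨χ, hχ, hker⟩ := BinaryTree.exists_character
    fun a b => BinaryTree.mul_mem_of_notMem hess hQ (a := a) (b := b)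
  exact BinaryTree.not_isTopologicallyFG_of_character (BinaryTree.exists_agree_mem hess hQ) htop
    hχ hker
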